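/- Let the integers $b(n)$, $n\ge 0$, be the coefficients of the second order mock theta function $$\mathcal{B}(q)=\sum_{n\ge 0}\frac{q^n(-q;q^2)_n}{(q;q^2)_{n+1}}=\sum_{n\ge 0}b(n)q^n,\qquad (a;q)_n:=\prod_{j=0}^{n-1}(1-aq^j).$$ Let $p$ be an odd prime. For every integer $\ell$ with $1\le \ell\le p-1$ and Legendre symbol $\left(\frac{4\ell+1}{p}\right)=-1$, we have, for all $n\ge 0$, $$b(2(pn+\ell))\equiv 0 \pmod 4.$$ Furthermore, for all $n\ge 0$ and $k\ge 0$, $$b(2n)\equiv(-1)^{\frac{(k+1)(1-p)}{2}}\,p^{-k-1}\,b\left(2p^{2k+2}n+\frac{p^{2k+2}-1}{2}\right)\pmod 4,$$ where $p^{-1}$ denotes the inverse of $p$ modulo $4$. -/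

import Mathlib

open PowerSeries

/-- The finite `q`-Pochhammer symbol `(a; q)_n = ∏_{j=0}^{n-1} (1 - a q ^ j)`. -/
def qPochhammer {R : Type*} [CommRing R] (a q : R) (n : ℕ) : R :=
  ∏ j ∈ Finset.range n, (1 - a * q ^ j)

/-- The `m`-th summand `q ^ m (-q; q²)_m / (q; q²)_{m+1}` of the second order mock theta function
`𝓑(q)`, as a formal power series in `q = X` with integer coefficients. The denominator has
constant term `1`, and `invOfUnit _ 1` is its inverse, see `mockThetaBTerm_mul`. -/
noncomputable def mockThetaBTerm (m : ℕ) : PowerSeries ℤ :=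
  X ^ m * qPochhammer (-X) (X ^ 2) m * invOfUnit (qPochhammer X (X ^ 2) (m + 1)) 1

/-- The coefficient `b(n)` of `q ^ n` in
`𝓑(q) = ∑_{m ≥ 0} q ^ m (-q; q²)_m / (q; q²)_{m+1}`. The summand with index `m` is divisible by
`q ^ m`, so only the indices `m ≤ n` contribute; see `hasSum_mockThetaB`. -/
noncomputable def mockThetaBCoeff (n : ℕ) : ℤ :=
  ∑ m ∈ Finset.range (n + 1), coeff n (mockThetaBTerm m)

/-- The second order mock theta function `𝓑(q) = ∑_{n ≥ 0} b(n) q ^ n`. -/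
noncomputable def mockThetaB : PowerSeries ℤ :=
  PowerSeries.mk mockThetaBCoeff

/-- `mockThetaBTerm m` is the quotient that it is meant to be. -/
theorem mockThetaBTerm_mul (m : ℕ) :
    mockThetaBTerm m * qPochhammer X (X ^ 2) (m + 1) = X ^ m * qPochhammer (-X) (X ^ 2) m := by
  have h : constantCoeff (qPochhammer (X : PowerSeries ℤ) (X ^ 2) (m + 1)) =
      ((1 : ℤˣ) : ℤ) := by
    simp [qPochhammer, map_prod]
  rw [mockThetaBTerm, mul_assoc, mul_comm (invOfUnit _ _), mul_invOfUnit _ _ h, mul_one]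

theorem coeff_mockThetaBTerm_of_lt {n m : ℕ} (h : n < m) : coeff n (mockThetaBTerm m) = 0 := by
  rw [mockThetaBTerm, mul_assoc, coeff_X_pow_mul', if_neg (by omega)]

open scoped PowerSeries.WithPiTopology in
/-- `𝓑(q)` is the sum of its defining series, coefficient by coefficient. -/
theorem hasSum_mockThetaB : HasSum mockThetaBTerm mockThetaB := by
  rw [PowerSeries.WithPiTopology.hasSum_iff_hasSum_coeff]
  intro n
  rw [mockThetaB, coeff_mk]
  have h : ∀ m ∉ Finset.range (n + 1), coeff n (mockThetaBTerm m) = 0 := fun m hm =>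
    coeff_mockThetaBTerm_of_lt (by rw [Finset.mem_range] at hm; omega)
  exact hasSum_sum_of_ne_finset_zero h

/-! Modulo 4, `(1 + x) / (1 - x) = 1 + 2x / (1 - x)`, and in a product of such factors all cross
terms vanish. Hence `b(N)` counts factorizations of `2N + 1` into two odd factors, plus twice the
`quadruples` (`mockThetaBCoeff_eq_card`). Only the parity of the latter matters, so an involution
reduces them to its fixed points. For `N = 2n` these correspond to factorizations of `4n + 1` with
first factor smaller than the second. The unequal factorizations then contribute 2 + 2 = 4 per
unordered pair, and only a square root of `4n + 1` survives (`mockThetaBCoeff_two_mul`). Both claims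
become statements about when `4n + 1` is a square. -/

/-! ### Reduction of the series modulo 4 -/

/-- The geometric series `1 / (1 - X ^ d)` over `ZMod 4`. -/
noncomputable def geomSeries (d : ℕ) : PowerSeries (ZMod 4) :=
  PowerSeries.mk fun n => if d ∣ n then 1 else 0

theorem one_sub_X_pow_mul_geomSeries {d : ℕ} (hd : 0 < d) :
    (1 - X ^ d) * geomSeries d = 1 := by
  ext n
  rw [sub_mul, one_mul, map_sub, coeff_X_pow_mul', coeff_one, geomSeries, coeff_mk]
  rcases Nat.eq_zero_or_pos n with rfl | hn
  · simp [hd.ne']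
  · rw [if_neg hn.ne']
    by_cases h : d ≤ n
    · rw [if_pos h, coeff_mk]
      rw [if_congr (Nat.dvd_sub_iff_left h dvd_rfl) rfl rfl, sub_self]
    · rw [if_neg h, if_neg fun hdvd => h (Nat.le_of_dvd hn hdvd), sub_zero]

theorem coeff_geomSeries_eq_sum {d n N : ℕ} (hd : 0 < d) (hn : n ≤ N) :
    coeff n (geomSeries d) = ∑ k ∈ Finset.range (N + 1), if k * d = n then 1 else 0 := by
  rw [geomSeries, coeff_mk]
  split_ifs with h
  · obtain ⟨c, rfl⟩ := h
    have hc : c ∈ Finset.range (N + 1) := by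
      rw [Finset.mem_range]
      nlinarith
    rw [Finset.sum_eq_single_of_mem c hc, if_pos (mul_comm c d)]
    intro k _ hk
    rw [if_neg]
    rw [mul_comm d c]
    exact fun hkc => hk (Nat.eq_of_mul_eq_mul_right hd hkc)
  · refine (Finset.sum_eq_zero fun k _ => if_neg ?_).symm
    rintro rfl
    exact h (dvd_mul_left d k)

theorem coeff_X_pow_mul_geomSeries {a d n N : ℕ} (hd : 0 < d) (hn : n ≤ N) :
    coeff n (X ^ a * geomSeries d) =
      ∑ k ∈ Finset.range (N + 1), if a + k * d = n then 1 else 0 := by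
  rw [coeff_X_pow_mul']
  split_ifs with h
  · rw [coeff_geomSeries_eq_sum hd ((Nat.sub_le n a).trans hn)]
    exact Finset.sum_congr rfl fun k _ => if_congr (by omega) rfl rfl
  · exact (Finset.sum_eq_zero fun k _ => if_neg (by omega)).symm

theorem coeff_mul_X_pow_mul_geomSeries {a d b e N : ℕ} (hd : 0 < d) (he : 0 < e) :
    coeff N (X ^ a * geomSeries d * (X ^ b * geomSeries e)) =
      ∑ k ∈ Finset.range (N + 1), ∑ i ∈ Finset.range (N + 1),
        if a + k * d + (b + i * e) = N then 1 else 0 := by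
  rw [coeff_mul]
  have h : ∀ x ∈ Finset.HasAntidiagonal.antidiagonal N,
      coeff x.1 (X ^ a * geomSeries d) * coeff x.2 (X ^ b * geomSeries e) =
        ∑ k ∈ Finset.range (N + 1), ∑ i ∈ Finset.range (N + 1),
          if (a + k * d, b + i * e) = x then (1 : ZMod 4) else 0 := by
    intro x hx
    have hx := Finset.HasAntidiagonal.mem_antidiagonal.1 hx
    rw [coeff_X_pow_mul_geomSeries hd (show x.1 ≤ N by omega),
      coeff_X_pow_mul_geomSeries he (show x.2 ≤ N by omega), Finset.sum_mul_sum]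
    refine Finset.sum_congr rfl fun k _ => Finset.sum_congr rfl fun i _ => ?_
    rw [ite_zero_mul_ite_zero, mul_one]
    exact if_congr (by rw [Prod.ext_iff]) rfl rfl
  rw [Finset.sum_congr rfl h, Finset.sum_comm]
  refine Finset.sum_congr rfl fun k _ => ?_
  rw [Finset.sum_comm]
  refine Finset.sum_congr rfl fun i _ => ?_
  rw [Finset.sum_ite_eq]
  exact if_congr Finset.HasAntidiagonal.mem_antidiagonal rfl rfl

theorem prod_one_add_X_pow_odd (m : ℕ) :
    ∏ j ∈ Finset.range m, (1 + X ^ (2 * j + 1) : PowerSeries (ZMod 4)) =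
      (1 + 2 * ∑ j ∈ Finset.range m, X ^ (2 * j + 1) * geomSeries (2 * j + 1)) *
        ∏ j ∈ Finset.range m, (1 - X ^ (2 * j + 1)) := by
  have h4 : (4 : PowerSeries (ZMod 4)) = 0 := by
    rw [← map_ofNat (C (R := ZMod 4)) 4, show (OfNat.ofNat 4 : ZMod 4) = 0 from rfl, map_zero]
  induction m with
  | zero => simp
  | succ m ih =>
    rw [Finset.prod_range_succ, Finset.prod_range_succ, Finset.sum_range_succ, ih]
    have hg := one_sub_X_pow_mul_geomSeries (Nat.succ_pos (2 * m))
    rw [Nat.succ_eq_add_one] at hg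
    generalize ∑ j ∈ Finset.range m,
      X ^ (2 * j + 1) * geomSeries (2 * j + 1) = S
    generalize ∏ j ∈ Finset.range m, (1 - X ^ (2 * j + 1) : PowerSeries (ZMod 4)) = P
    linear_combination (-2 * P * X ^ (2 * m + 1)) * hg
      + P * S * X ^ (2 * m + 1) * h4

theorem map_mockThetaBTerm (m : ℕ) :
    PowerSeries.map (Int.castRingHom (ZMod 4)) (mockThetaBTerm m) =
      X ^ m * geomSeries (2 * m + 1) *
        (1 + 2 * ∑ j ∈ Finset.range m, X ^ (2 * j + 1) * geomSeries (2 * j + 1)) := by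
  have h := congrArg (PowerSeries.map (Int.castRingHom (ZMod 4))) (mockThetaBTerm_mul m)
  have hX (j : ℕ) : (X : PowerSeries (ZMod 4)) * (X ^ 2) ^ j = X ^ (2 * j + 1) := by ring
  simp only [qPochhammer, map_mul, map_prod, map_sub, map_one, map_pow, PowerSeries.map_X,
    neg_mul, sub_neg_eq_add, map_add, hX, prod_one_add_X_pow_odd] at h
  rw [Finset.prod_range_succ] at h
  have hinv : (∏ j ∈ Finset.range m, (1 - X ^ (2 * j + 1) : PowerSeries (ZMod 4))) *
      ∏ j ∈ Finset.range m, geomSeries (2 * j + 1) = 1 := by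
    rw [← Finset.prod_mul_distrib]
    exact Finset.prod_eq_one fun j _ => one_sub_X_pow_mul_geomSeries (Nat.succ_pos _)
  have hg := one_sub_X_pow_mul_geomSeries (Nat.succ_pos (2 * m))
  rw [Nat.succ_eq_add_one] at hg
  generalize ∑ j ∈ Finset.range m, X ^ (2 * j + 1) * geomSeries (2 * j + 1) = S at *
  generalize ∏ j ∈ Finset.range m, (1 - X ^ (2 * j + 1) : PowerSeries (ZMod 4)) = P at *
  generalize ∏ j ∈ Finset.range m, geomSeries (2 * j + 1) = Q at *
  generalize PowerSeries.map (Int.castRingHom (ZMod 4)) (mockThetaBTerm m) = T at *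
  generalize geomSeries (2 * m + 1) = G at *
  -- `Q` and `G` invert `P` and `1 - X ^ (2 * m + 1)`, so multiplying `h` by `G * Q` clears the
  -- denominator.
  linear_combination G * Q * h - T * hg - T * (1 - X ^ (2 * m + 1)) * G * hinv +
    X ^ m * (1 + 2 * S) * G * hinv

/-! ### Coefficients as counts of solutions -/

/-- The quadruples `(m, k, j, i)` with `j < m` and
`(2m + 1)(2k + 1) + 2(i + 1)(2j + 1) = 2N + 1`. -/
def quadruples (N : ℕ) : Finset (ℕ × ℕ × ℕ × ℕ) :=
  (Finset.range (N + 1) ×ˢ Finset.range (N + 1) ×ˢ Finset.range (N + 1) ×ˢ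
    Finset.range (N + 1)).filter
      fun x => x.2.2.1 < x.1 ∧
        x.1 + x.2.1 * (2 * x.1 + 1) + (x.2.2.2 + 1) * (2 * x.2.2.1 + 1) = N

theorem mem_quadruples {N m k j i : ℕ} :
    (m, k, j, i) ∈ quadruples N ↔
      j < m ∧ m + k * (2 * m + 1) + (i + 1) * (2 * j + 1) = N := by
  simp only [quadruples, Finset.mem_filter, Finset.mem_product, Finset.mem_range,
    and_iff_right_iff_imp]
  rintro ⟨h1, h2⟩
  refine ⟨?_, ?_, ?_, ?_⟩ <;> nlinarith [Nat.zero_le (k * m), Nat.zero_le (i * j)]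

/-- The pairs `(m, k)` with `(2m + 1)(2k + 1) = 2N + 1`. -/
def oddFactorPairs (N : ℕ) : Finset (ℕ × ℕ) :=
  (Finset.range (N + 1) ×ˢ Finset.range (N + 1)).filter
    fun x => x.1 + x.2 * (2 * x.1 + 1) = N

theorem mem_oddFactorPairs {N m k : ℕ} :
    (m, k) ∈ oddFactorPairs N ↔ m + k * (2 * m + 1) = N := by
  simp only [oddFactorPairs, Finset.mem_filter, Finset.mem_product, Finset.mem_range,
    and_iff_right_iff_imp]
  intro h
  constructor <;> nlinarith [Nat.zero_le (k * m)]

theorem sum_coeff_two_mul (N : ℕ) :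
    ∑ m ∈ Finset.range (N + 1), coeff N (X ^ m * geomSeries (2 * m + 1) *
      ∑ j ∈ Finset.range m, X ^ (2 * j + 1) * geomSeries (2 * j + 1)) =
      ((quadruples N).card : ZMod 4) := by
  rw [Finset.card_eq_sum_ones, quadruples, Finset.sum_filter, Nat.cast_sum,
    Finset.sum_product]
  refine Finset.sum_congr rfl fun m hm => ?_
  rw [Finset.mul_sum, map_sum, Finset.sum_product]
  have h : ∀ j ∈ Finset.range m,
      coeff N (X ^ m * geomSeries (2 * m + 1) * (X ^ (2 * j + 1) * geomSeries (2 * j + 1))) =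
        ∑ k ∈ Finset.range (N + 1), ∑ i ∈ Finset.range (N + 1),
          if m + k * (2 * m + 1) + (i + 1) * (2 * j + 1) = N then (1 : ZMod 4) else 0 := by
    intro j _
    rw [coeff_mul_X_pow_mul_geomSeries (Nat.succ_pos _) (Nat.succ_pos _)]
    exact Finset.sum_congr rfl fun k _ => Finset.sum_congr rfl fun i _ =>
      if_congr (by rw [add_one_mul i, add_comm (i * _)]) rfl rfl
  rw [Finset.sum_congr rfl h, Finset.sum_comm]
  refine Finset.sum_congr rfl fun k _ => ?_
  have hr : Finset.range m = (Finset.range (N + 1)).filter (· < m) := by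
    ext j
    simp only [Finset.mem_range, Finset.mem_filter] at hm ⊢
    omega
  rw [Finset.sum_product, hr, Finset.sum_filter]
  refine Finset.sum_congr rfl fun j _ => ?_
  split_ifs with hj
  · simp [hj]
  · simp [hj]

theorem mockThetaBCoeff_eq_card (N : ℕ) :
    (mockThetaBCoeff N : ZMod 4) =
      (oddFactorPairs N).card + 2 * (quadruples N).card := by
  have hterm (m : ℕ) : ((coeff N (mockThetaBTerm m) : ℤ) : ZMod 4) =
      coeff N (X ^ m * geomSeries (2 * m + 1)) + 2 * coeff N (X ^ m * geomSeries (2 * m + 1) *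
        ∑ j ∈ Finset.range m, X ^ (2 * j + 1) * geomSeries (2 * j + 1)) := by
    have h := congrArg (coeff N) (map_mockThetaBTerm m)
    rw [PowerSeries.coeff_map, eq_intCast] at h
    rw [h, mul_add, mul_one, map_add, mul_left_comm, two_mul (_ * _), map_add, two_mul (coeff N _)]
  rw [mockThetaBCoeff, Int.cast_sum, Finset.sum_congr rfl fun m _ => hterm m,
    Finset.sum_add_distrib, ← Finset.mul_sum, sum_coeff_two_mul]
  congr 1
  rw [Finset.card_eq_sum_ones, oddFactorPairs, Finset.sum_filter, Nat.cast_sum,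
    Finset.sum_product]
  refine Finset.sum_congr rfl fun m _ => ?_
  rw [coeff_X_pow_mul_geomSeries (Nat.succ_pos _) le_rfl]
  exact Finset.sum_congr rfl fun k _ => by push_cast; rfl

/-! ### The involution and its fixed points -/

/-- An involution on `quadruples N`: writing `a = 2m + 1`, `c = 2k + 1`, `e = 2j + 1`, it
interchanges the two sides of `a c + 2 (i + 1) e = e (c + 2 (i + 1)) + (a - e) c`. -/
def quadrupleSwap (x : ℕ × ℕ × ℕ × ℕ) : ℕ × ℕ × ℕ × ℕ :=
  (x.2.1 + x.2.2.2 + 1, x.2.2.1, x.2.1, x.1 - x.2.2.1 - 1)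

theorem quadrupleSwap_mem {N : ℕ} {x : ℕ × ℕ × ℕ × ℕ} (hx : x ∈ quadruples N) :
    quadrupleSwap x ∈ quadruples N := by
  obtain ⟨m, k, j, i⟩ := x
  obtain ⟨h1, h2⟩ := mem_quadruples.1 hx
  obtain ⟨t, rfl⟩ := Nat.exists_eq_add_of_lt h1
  refine mem_quadruples.2 ⟨by dsimp only; omega, ?_⟩
  rw [← h2]
  dsimp only
  rw [show j + t + 1 - j - 1 = t by omega]
  ring

theorem quadrupleSwap_quadrupleSwap {N : ℕ} {x : ℕ × ℕ × ℕ × ℕ} (hx : x ∈ quadruples N) :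
    quadrupleSwap (quadrupleSwap x) = x := by
  obtain ⟨m, k, j, i⟩ := x
  obtain ⟨h1, -⟩ := mem_quadruples.1 hx
  simp only [quadrupleSwap, Prod.mk.injEq, true_and]
  omega

/-- Quadruples that are not fixed pair off, and each pair contributes 2 + 2 = 0. -/
theorem two_mul_card_quadruples (N : ℕ) :
    (2 * (quadruples N).card : ZMod 4) =
      2 * ((quadruples N).filter fun x => quadrupleSwap x = x).card := by
  have h0 : ∑ x ∈ (quadruples N).filter (fun x => ¬ quadrupleSwap x = x), (2 : ZMod 4) = 0 := by
    refine Finset.sum_involution (fun x _ => quadrupleSwap x) (fun _ _ => rfl) ?_ ?_ ?_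
    · exact fun x hx _ => (Finset.mem_filter.1 hx).2
    · intro x hx
      obtain ⟨h1, h2⟩ := Finset.mem_filter.1 hx
      refine Finset.mem_filter.2 ⟨quadrupleSwap_mem h1, fun h => h2 ?_⟩
      rwa [quadrupleSwap_quadrupleSwap h1, eq_comm] at h
    · exact fun x hx => quadrupleSwap_quadrupleSwap (Finset.mem_filter.1 hx).1
  rw [Finset.sum_const, nsmul_eq_mul] at h0
  rw [← Finset.card_filter_add_card_filter_not (s := quadruples N) (fun x => quadrupleSwap x = x)]
  push_cast
  linear_combination h0

/-- A fixed point has `j = k` and `m = k + i + 1`, and its equation factors as `(2k + 1)(2(k + 2(i +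
1)) + 1) = 4n + 1`. -/
theorem card_fixed_quadruples (n : ℕ) :
    ((quadruples (2 * n)).filter fun x => quadrupleSwap x = x).card =
      ((oddFactorPairs (2 * n)).filter fun x => x.1 < x.2).card := by
  refine Finset.card_nbij' (fun x => (x.2.1, x.2.1 + 2 * (x.2.2.2 + 1)))
    (fun y => ((y.1 + y.2) / 2, y.1, y.1, (y.2 - y.1) / 2 - 1)) ?_ ?_ ?_ ?_
  · rintro ⟨m, k, j, i⟩ hx
    obtain ⟨h1, h2⟩ := Finset.mem_filter.1 hx
    obtain ⟨-, h1⟩ := mem_quadruples.1 h1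
    simp only [quadrupleSwap, Prod.mk.injEq] at h2
    obtain ⟨rfl, rfl, -, -⟩ := h2
    refine Finset.mem_filter.2 ⟨mem_oddFactorPairs.2 ?_, by dsimp only; omega⟩
    rw [← h1]
    ring
  · rintro ⟨m, k⟩ hx
    obtain ⟨h1, h2⟩ := Finset.mem_filter.1 hx
    have h1 := mem_oddFactorPairs.1 h1
    -- With `h1` this shows that `m + k` is even, so `k - m` is a positive even number; this is
    -- where the even index is needed.
    have h3 : k * (2 * m + 1) = 2 * (k * m) + k := by ring
    obtain ⟨t, rfl⟩ : ∃ t, k = m + 2 * (t + 1) := ⟨(k - m) / 2 - 1, by dsimp only at h2; omega⟩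
    have h4 : (m + (m + 2 * (t + 1))) / 2 = m + t + 1 := by omega
    have h5 : (m + 2 * (t + 1) - m) / 2 - 1 = t := by omega
    simp only [h4, h5]
    refine Finset.mem_coe.2 (Finset.mem_filter.2 ⟨mem_quadruples.2 ⟨by omega, ?_⟩, ?_⟩)
    · rw [← h1]
      ring
    · simp only [quadrupleSwap, Prod.mk.injEq, true_and]
      omega
  · rintro ⟨m, k, j, i⟩ hx
    obtain ⟨-, h2⟩ := Finset.mem_filter.1 hx
    simp only [quadrupleSwap, Prod.mk.injEq, true_and] at h2 ⊢
    omega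
  · rintro ⟨m, k⟩ hx
    obtain ⟨h1, h2⟩ := Finset.mem_filter.1 hx
    have h1 := mem_oddFactorPairs.1 h1
    have h3 : k * (2 * m + 1) = 2 * (k * m) + k := by ring
    simp only [Prod.mk.injEq, true_and] at h2 ⊢
    omega

/-! ### Factorizations and squares -/

theorem card_oddFactorPairs (N : ℕ) :
    (oddFactorPairs N).card = 2 * ((oddFactorPairs N).filter fun x => x.1 < x.2).card +
      ((oddFactorPairs N).filter fun x => x.1 = x.2).card := by
  have hswap : ((oddFactorPairs N).filter fun x => x.2 < x.1).card =
      ((oddFactorPairs N).filter fun x => x.1 < x.2).card := by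
    refine Finset.card_nbij' Prod.swap Prod.swap ?_ ?_ (fun _ _ => rfl) (fun _ _ => rfl) <;>
    · rintro ⟨m, k⟩ hx
      obtain ⟨h1, h2⟩ := Finset.mem_filter.1 hx
      refine Finset.mem_filter.2 ⟨mem_oddFactorPairs.2 ?_, h2⟩
      rw [← mem_oddFactorPairs.1 h1]
      ring
  have h1 := Finset.card_filter_add_card_filter_not (s := oddFactorPairs N) (fun x => x.1 < x.2)
  have h2 := Finset.card_filter_add_card_filter_not
    (s := (oddFactorPairs N).filter fun x => ¬ x.1 < x.2) (fun x => x.2 < x.1)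
  have h3 : ((oddFactorPairs N).filter fun x => ¬ x.1 < x.2).filter (fun x => x.2 < x.1) =
      (oddFactorPairs N).filter fun x => x.2 < x.1 := by
    rw [Finset.filter_filter]
    exact Finset.filter_congr fun x _ => by omega
  have h4 : ((oddFactorPairs N).filter fun x => ¬ x.1 < x.2).filter (fun x => ¬ x.2 < x.1) =
      (oddFactorPairs N).filter fun x => x.1 = x.2 := by
    rw [Finset.filter_filter]
    exact Finset.filter_congr fun x _ => by omega
  rw [h3, h4, hswap] at h2
  omega

theorem card_diagonal_oddFactorPairs (n : ℕ) :
    ((oddFactorPairs (2 * n)).filter fun x => x.1 = x.2).card =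
      if IsSquare (4 * n + 1) then 1 else 0 := by
  have hmem (m k : ℕ) : (m, k) ∈ (oddFactorPairs (2 * n)).filter (fun x => x.1 = x.2) ↔
      m = k ∧ (2 * m + 1) * (2 * m + 1) = 4 * n + 1 := by
    rw [Finset.mem_filter, mem_oddFactorPairs, and_comm]
    dsimp only
    refine and_congr_right ?_
    rintro rfl
    constructor <;> intro h <;> linarith
  split_ifs with h
  · obtain ⟨r, hr⟩ := h
    obtain ⟨m, rfl⟩ : Odd r := by
      have h1 : Odd (r * r) := hr ▸ ⟨2 * n, by ring⟩
      exact (Nat.odd_mul.1 h1).1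
    rw [Finset.card_eq_one]
    refine ⟨(m, m), ?_⟩
    ext ⟨a, b⟩
    rw [hmem, Finset.mem_singleton, Prod.mk.injEq]
    constructor
    · rintro ⟨rfl, h⟩
      have := Nat.mul_self_inj.1 (h.trans hr)
      omega
    · rintro ⟨rfl, rfl⟩
      exact ⟨rfl, hr.symm⟩
  · rw [Finset.card_eq_zero, Finset.eq_empty_iff_forall_notMem]
    rintro ⟨a, b⟩ hab
    exact h ⟨_, ((hmem a b).1 hab).2.symm⟩

/-- Modulo `4`, the even part of `𝓑` is `∑ q ^ (j (j + 1))`. -/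
theorem mockThetaBCoeff_two_mul (n : ℕ) :
    (mockThetaBCoeff (2 * n) : ZMod 4) = if IsSquare (4 * n + 1) then 1 else 0 := by
  have h4 : (4 : ZMod 4) = 0 := rfl
  have hd := card_diagonal_oddFactorPairs n
  rw [mockThetaBCoeff_eq_card, two_mul_card_quadruples, card_fixed_quadruples,
    card_oddFactorPairs, hd]
  push_cast
  linear_combination
    (((oddFactorPairs (2 * n)).filter fun x => x.1 < x.2).card : ZMod 4) * h4

/-- For odd `p`, `(-1) ^ ((1 - p) / 2)` is congruent to `p` modulo 4, so the twist in the second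
claim is trivial. -/
theorem neg_one_zpow_mul_inv_pow {p : ℕ} (hp : Odd p) (k : ℕ) :
    (((-1 : (ZMod 4)ˣ) ^ (((k : ℤ) + 1) * (1 - (p : ℤ)) / 2) : (ZMod 4)ˣ) : ZMod 4) *
      ((p : ZMod 4)⁻¹) ^ (k + 1) = 1 := by
  have h4 : (4 : ZMod 4) = 0 := rfl
  obtain ⟨r, rfl⟩ := hp
  have he : ((k : ℤ) + 1) * (1 - ((2 * r + 1 : ℕ) : ℤ)) / 2 = -(r : ℤ) * (k + 1 : ℕ) := by
    rw [show ((k : ℤ) + 1) * (1 - ((2 * r + 1 : ℕ) : ℤ)) = -(r : ℤ) * (k + 1 : ℕ) * 2 by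
      push_cast; ring, Int.mul_ediv_cancel _ two_ne_zero]
  rw [he, zpow_mul, zpow_natCast, Units.val_pow_eq_pow_val, ← mul_pow]
  suffices h : (((-1 : (ZMod 4)ˣ) ^ (-(r : ℤ)) : (ZMod 4)ˣ) : ZMod 4) *
      ((2 * r + 1 : ℕ) : ZMod 4)⁻¹ = 1 by rw [h, one_pow]
  obtain ⟨s, rfl | rfl⟩ := Nat.even_or_odd' r
  · have h1 : ((2 * (2 * s) + 1 : ℕ) : ZMod 4) = 1 := by
      push_cast
      linear_combination (s : ZMod 4) * h4
    rw [h1, Even.neg_one_zpow (by simp), Units.val_one, one_mul]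
    exact ZMod.inv_one 4
  · have h1 : ((2 * (2 * s + 1) + 1 : ℕ) : ZMod 4) = 3 := by
      push_cast
      linear_combination (s : ZMod 4) * h4
    rw [h1, Odd.neg_one_zpow ⟨-(s : ℤ) - 1, by push_cast; ring⟩]
    exact (congrArg _ (ZMod.inv_eq_of_mul_eq_one 4 (3 : ZMod 4) 3 rfl)).trans rfl

theorem theorem1p2 (p : ℕ) [Fact p.Prime] (hp : Odd p) :
    (∀ ℓ : ℕ, 1 ≤ ℓ → ℓ ≤ p - 1 → legendreSym p (4 * (ℓ : ℤ) + 1) = -1 →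
      ∀ n : ℕ, mockThetaBCoeff (2 * (p * n + ℓ)) ≡ 0 [ZMOD 4]) ∧
    (∀ n k : ℕ,
      (mockThetaBCoeff (2 * n) : ZMod 4) =
        (((-1 : (ZMod 4)ˣ) ^ (((k : ℤ) + 1) * (1 - (p : ℤ)) / 2) : (ZMod 4)ˣ) : ZMod 4) *
          ((p : ZMod 4)⁻¹) ^ (k + 1) *
          (mockThetaBCoeff (2 * p ^ (2 * k + 2) * n + (p ^ (2 * k + 2) - 1) / 2) : ZMod 4)) := by
  constructor
  · intro ℓ _ _ hℓ n
    refine (ZMod.intCast_eq_intCast_iff _ _ 4).1 ?_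
    rw [mockThetaBCoeff_two_mul, if_neg, Int.cast_zero]
    rintro ⟨r, hr⟩
    -- Modulo `p`, a square root of `4(pn + ℓ) + 1` is one of `4ℓ + 1`.
    refine (legendreSym.eq_neg_one_iff p).1 hℓ ⟨(r : ZMod p), ?_⟩
    have h := congrArg (Nat.cast : ℕ → ZMod p) hr
    push_cast at h ⊢
    rw [CharP.cast_eq_zero, zero_mul, zero_add] at h
    exact h
  · intro n k
    have hpos : 0 < p := hp.pos
    obtain ⟨s, hs⟩ : ∃ s, p ^ (2 * k + 2) = 4 * s + 1 := by
      obtain ⟨r, hr⟩ := hp.pow (n := k + 1)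
      exact ⟨r * r + r, by rw [show 2 * k + 2 = (k + 1) * 2 by ring, pow_mul, hr]; ring⟩
    have hidx : 2 * p ^ (2 * k + 2) * n + (p ^ (2 * k + 2) - 1) / 2 =
        2 * (p ^ (2 * k + 2) * n + s) := by
      rw [mul_add, ← mul_assoc]
      omega
    -- The new index multiplies `4n + 1` by the square `p ^ (2k + 2)`.
    have hsq : IsSquare (4 * (p ^ (2 * k + 2) * n + s) + 1) ↔ IsSquare (4 * n + 1) := by
      rw [show 4 * (p ^ (2 * k + 2) * n + s) + 1 = (p ^ (k + 1)) ^ 2 * (4 * n + 1) by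
        rw [← pow_mul, show (k + 1) * 2 = 2 * k + 2 by ring, hs]; ring]
      constructor
      · rintro ⟨r, hr⟩
        obtain ⟨c, rfl⟩ : p ^ (k + 1) ∣ r :=
          (Nat.pow_dvd_pow_iff two_ne_zero).1 ⟨4 * n + 1, by rw [hr, sq]⟩
        refine ⟨c, Nat.eq_of_mul_eq_mul_left (pow_pos (pow_pos hpos (k + 1)) 2) ?_⟩
        rw [hr]
        ring
      · exact fun h => (IsSquare.sq _).mul h
    rw [neg_one_zpow_mul_inv_pow hp, one_mul, hidx, mockThetaBCoeff_two_mul,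
      mockThetaBCoeff_two_mul]
    simp only [hsq]
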